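/- Let $k\ge 6$ and $g=2d\ge 6$ be integers, and let $G$ be a $(k,g)$-graph of excess $4$, that is, a finite simple $k$-regular graph whose girth (length of a shortest cycle) is exactly $g$ and whose number of vertices is $$n=2\left(1+(k-1)+(k-1)^2+\dots+(k-1)^{d-1}\right)+4 .$$ Let $A$ be the adjacency matrix of $G$, let $I$ and $J$ be the $n\times n$ identity and all-ones matrices, and let $E$ be the excess matrix of $G$, i.e. the $n\times n$ matrix whose $(u,v)$ entry is $1$ if $u$ and $v$ are at distance $d+1$ in $G$ and $0$ otherwise. Let $H_i(x)$ be the Dickson polynomials of the second kind with parameter $k-1$, given by $H_0(x)=1$, $H_1(x)=x$ and $H_{i+1}(x)=xH_i(x)-(k-1)H_{i-1}(x)$ for $i\ge 1$. Then $$kJ=(A+kI)\left(H_{d-1}(A)+E\right).$$ -/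

import Mathlib

/-- A finite simple graph is a `(k, g)`-graph if it is `k`-regular and its girth (the length of a
shortest cycle) is exactly `g`. -/
def SimpleGraph.IsKGGraph {V : Type*} [Fintype V] (G : SimpleGraph V) [DecidableRel G.Adj]
    (k g : ℕ) : Prop :=
  G.IsRegularOfDegree k ∧ G.egirth = (g : ℕ∞)

/-- The Moore bound `M(k, g)`:
`1 + k + k(k-1) + ... + k(k-1)^((g-3)/2)` for odd `g`, and
`2(1 + (k-1) + ... + (k-1)^((g-2)/2))` for even `g`. -/
def mooreBound (k g : ℕ) : ℤ :=
  if Odd g then 1 + ∑ i ∈ Finset.range ((g - 1) / 2), (k : ℤ) * ((k : ℤ) - 1) ^ i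
  else 2 * ∑ i ∈ Finset.range (g / 2), ((k : ℤ) - 1) ^ i

/-- `G` is a `(k, g)`-graph of excess `e`, the excess being the difference between the order of the
graph and the Moore bound. -/
def SimpleGraph.IsKGGraphOfExcess {V : Type*} [Fintype V] (G : SimpleGraph V)
    [DecidableRel G.Adj] (k g : ℕ) (e : ℤ) : Prop :=
  G.IsKGGraph k g ∧ (Fintype.card V : ℤ) - mooreBound k g = e

open Classical in
/-- The `i`-distance matrix `A_i` of a graph: the entry at `(u, v)` is `1` if `u` and `v` are at
distance `i`, and `0` otherwise. -/
noncomputable def SimpleGraph.distanceMatrix {V : Type*} (G : SimpleGraph V) (i : ℕ) :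
    Matrix V V ℝ :=
  Matrix.of fun u v => if G.edist u v = (i : ℕ∞) then 1 else 0

/-- The all-ones matrix `J`. -/
def allOnesMatrix (V : Type*) : Matrix V V ℝ :=
  Matrix.of fun _ _ => 1

/-!
Put `d = g / 2`. Counting the Moore tree that grows from an edge `uv`, exactly `e` vertices (the
excess) are at distance at least `d` from both `u` and `v`, and they cover all edges of `G` between
vertices at distance at least `d` from `u`. In the graph `Γ` of these outer edges the degree of `s`
is the number of neighbours of `u` at distance at least `d` from `s`, so the degrees of the two ends
of an outer edge add up to at least `k`. Suppose that both ends of an edge `pq` are at distance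
exactly `d` from `u`. Suitable choices of `v` give a cover of size `e` that avoids `p`, so every
neighbour of `p` has degree at least `k - e ≥ 2` in `Γ`, and one that avoids `q`; since `Γ` has
girth at least `5`, this forces `deg p + deg q ≤ e + 1 < k`, a contradiction.

Hence the distances from `u` to the ends of any edge have opposite parity, and no distance exceeds
`d + 1`. The Dickson recurrence identifies `H_{d-1}(A)` with `A_{d-1} + A_{d-3} + ⋯`, so adding
`E = A_{d+1}` yields the indicator of even `dist u v + d + 1`, and multiplying it by `A` gives `k`
times the complementary indicator.
-/

open Finset SimpleGraph

section Girth

variable {V : Type*} {G : SimpleGraph V} {u v w w' : V}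

theorem egirth_le_length_add_length {p q : G.Walk u v} (hp : p.IsPath) (hq : q.IsPath)
    (hne : p ≠ q) : G.egirth ≤ ((p.length + q.length : ℕ) : ℕ∞) := by
  obtain ⟨_, -, -, c, hc, hlen⟩ := hp.exists_isCycle_length_le_add_of_ne hq hne
  exact (egirth_le_length hc).trans (by exact_mod_cast hlen)

theorem not_adj_of_four_le_egirth (hgirth : 4 ≤ G.egirth) (huv : G.Adj u v) (hvw : G.Adj v w) :
    ¬ G.Adj u w := by
  intro huw
  have hle := egirth_le_length_add_length (p := huw.toWalk)
    (q := .cons huv hvw.toWalk) (by simp [huw.ne]) (by simp [huv.ne, huw.ne, hvw.ne])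
    (fun h => by simpa using congrArg Walk.length h)
  have := hgirth.trans hle
  norm_num at this

theorem eq_of_common_neighbors_of_five_le_egirth (hgirth : 5 ≤ G.egirth) (huv : u ≠ v)
    (huw : G.Adj u w) (hvw : G.Adj v w) (huw' : G.Adj u w') (hvw' : G.Adj v w') : w = w' := by
  by_contra hne
  have hle := egirth_le_length_add_length (p := .cons huw hvw.symm.toWalk)
    (q := .cons huw' hvw'.symm.toWalk) (by simp [huw.ne, huv, hvw.ne'])
    (by simp [huw'.ne, huv, hvw'.ne']) (by rintro ⟨⟩; exact hne rfl)
  have := hgirth.trans hle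
  norm_num at this

theorem dist_le_dist_add_one (hvw : G.Adj v w) : G.dist u v ≤ G.dist u w + 1 := by
  have := hvw.diff_dist_adj (u := u)
  omega

theorem dist_le_dist_add_one_left (huv : G.Adj u v) (w : V) : G.dist u w ≤ G.dist v w + 1 := by
  rw [dist_comm (v := w), dist_comm (v := w)]
  exact dist_le_dist_add_one huv

theorem exists_adj_dist_add_one_eq (h : G.dist u v ≠ 0) :
    ∃ w, G.Adj v w ∧ G.dist u w + 1 = G.dist u v := by
  rw [dist_comm] at h
  obtain ⟨p, hp⟩ := exists_walk_of_dist_ne_zero h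
  cases p with
  | nil => exact absurd hp.symm h
  | @cons _ w _ hvw p =>
    refine ⟨w, hvw, le_antisymm ?_ (dist_le_dist_add_one hvw)⟩
    rw [dist_comm (u := u), dist_comm (u := u), ← hp, Walk.length_cons]
    exact Nat.succ_le_succ (dist_le p)

theorem egirth_le_of_two_closer_neighbors (hw : G.Adj v w) (hw' : G.Adj v w') (hne : w ≠ w')
    (h : G.dist u w + 1 = G.dist u v) (h' : G.dist u w' + 1 = G.dist u v) :
    G.egirth ≤ ((2 * G.dist u v : ℕ) : ℕ∞) := by
  have hr : G.Reachable v u := (Reachable.of_dist_ne_zero (by omega)).symm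
  obtain ⟨p, hp⟩ := (hw.reachable.symm.trans hr).exists_walk_length_eq_dist
  obtain ⟨q, hq⟩ := (hw'.reachable.symm.trans hr).exists_walk_length_eq_dist
  have hp' : (Walk.cons hw p).length = G.dist v u := by
    rw [Walk.length_cons, hp, dist_comm, h, dist_comm]
  have hq' : (Walk.cons hw' q).length = G.dist v u := by
    rw [Walk.length_cons, hq, dist_comm, h', dist_comm]
  have hle := egirth_le_length_add_length (Walk.isPath_of_length_eq_dist _ hp')
    (Walk.isPath_of_length_eq_dist _ hq') (by rintro ⟨⟩; exact hne rfl)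
  rwa [hp', hq', ← two_mul, dist_comm] at hle

theorem egirth_le_of_adj_of_dist_eq (hr : G.Reachable u v) (hvw : G.Adj v w)
    (h : G.dist u v = G.dist u w) : G.egirth ≤ ((2 * G.dist u v + 1 : ℕ) : ℕ∞) := by
  classical
  obtain ⟨p, hp, hpv⟩ := hr.symm.exists_path_of_dist
  obtain ⟨q, hq, hqw⟩ := (hvw.reachable.symm.trans hr.symm).exists_path_of_dist
  rw [dist_comm, ← h] at hqw
  rw [dist_comm] at hpv
  have hv : v ∉ q.support := fun hmem => by
    have hlt := Walk.length_dropUntil_lt_length hmem hvw.ne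
    have hge := dist_le (q.dropUntil v hmem)
    rw [dist_comm] at hge
    omega
  have hle := egirth_le_length_add_length hp (hq.cons hv (h := hvw))
    (fun heq => by simpa [hpv, hqw] using congrArg Walk.length heq)
  rwa [Walk.length_cons, hpv, hqw, ← add_assoc, ← two_mul] at hle

end Girth

section VertexCover

variable {V : Type*} [Fintype V] {H : SimpleGraph V} [DecidableRel H.Adj] {C : Finset V} {p q r : V}

theorem neighborFinset_subset_of_isVertexCover (hC : H.IsVertexCover C) (hp : p ∉ C) :
    H.neighborFinset p ⊆ C :=
  fun _ hr => (hC ((mem_neighborFinset _ _ _).mp hr)).resolve_left hp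

theorem exists_mem_sdiff_neighborFinset_of_isVertexCover [DecidableEq V] (hH : 5 ≤ H.egirth)
    (hC : H.IsVertexCover C) (hpq : H.Adj p q) (hpr : H.Adj p r) (hrq : r ≠ q)
    (hdeg : 2 ≤ H.degree r) :
    ∃ s ∈ C \ H.neighborFinset q, s = r ∨ H.Adj r s ∧ s ≠ p := by
  simp only [mem_sdiff, mem_neighborFinset]
  by_cases hrC : r ∈ C
  · exact ⟨r, ⟨hrC, not_adj_of_four_le_egirth (le_trans (by norm_num) hH) hpq.symm hpr⟩, .inl rfl⟩
  · obtain ⟨s, hs, hsp⟩ := exists_mem_ne (s := H.neighborFinset r) hdeg p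
    rw [mem_neighborFinset] at hs
    refine ⟨s, ⟨(hC hs).resolve_left hrC, fun hqs => hrq ?_⟩, .inr ⟨hs, hsp⟩⟩
    exact eq_of_common_neighbors_of_five_le_egirth hH hsp.symm hpr hs.symm hpq hqs.symm

theorem degree_add_degree_le_card_add_one_of_isVertexCover (hH : 5 ≤ H.egirth)
    (hC : H.IsVertexCover C) (hpq : H.Adj p q) (hq : q ∉ C)
    (hdeg : ∀ r, H.Adj p r → 2 ≤ H.degree r) : H.degree p + H.degree q ≤ #C + 1 := by
  classical
  have no_triangle {a b c : V} (hab : H.Adj a b) (hbc : H.Adj b c) : ¬ H.Adj a c :=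
    not_adj_of_four_le_egirth (le_trans (by norm_num) hH) hab hbc
  -- Charge each neighbour `r ≠ q` of `p` to itself or to another neighbour of `r`, inside `C`.
  have charge : ∀ r ∈ (H.neighborFinset p).erase q,
      ∃ s ∈ C \ H.neighborFinset q, s = r ∨ H.Adj r s ∧ s ≠ p := by
    intro r hr
    obtain ⟨hrq, hpr⟩ : r ≠ q ∧ H.Adj p r := by simpa using hr
    exact exists_mem_sdiff_neighborFinset_of_isVertexCover hH hC hpq hpr hrq (hdeg r hpr)
  choose! f hfC hf using charge
  have f_inj : Set.InjOn f ((H.neighborFinset p).erase q) := by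
    intro r hr r' hr' heq
    have hfr := hf r hr
    have hfr' := hf r' hr'
    rw [← heq] at hfr'
    have hpr : H.Adj p r := by simpa using mem_of_mem_erase hr
    have hpr' : H.Adj p r' := by simpa using mem_of_mem_erase hr'
    rcases hfr with hfr | ⟨hrs, hsp⟩ <;> rcases hfr' with hfr' | ⟨hrs', _⟩
    · exact hfr.symm.trans hfr'
    · exact absurd hpr (no_triangle hpr' (hfr ▸ hrs'))
    · exact absurd hpr' (no_triangle hpr (hfr' ▸ hrs))
    · exact eq_of_common_neighbors_of_five_le_egirth hH hsp.symm hpr hrs.symm hpr' hrs'.symm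
  have hcard := card_le_card_of_injOn f hfC f_inj
  rw [card_erase_of_mem (by simpa using hpq), card_sdiff_of_subset
    (neighborFinset_subset_of_isVertexCover hC hq), card_neighborFinset_eq_degree,
    card_neighborFinset_eq_degree] at hcard
  have := card_le_card (neighborFinset_subset_of_isVertexCover hC hq)
  rw [card_neighborFinset_eq_degree] at this
  omega

end VertexCover

section MooreTree

variable {V : Type*} {G : SimpleGraph V} {d k e : ℕ} {u v w : V}

theorem dist_ne_dist_of_adj_of_lt (hgirth : ((2 * d : ℕ) : ℕ∞) ≤ G.egirth) (hr : G.Reachable u v)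
    (hvw : G.Adj v w) (hd : G.dist u v < d) : G.dist u v ≠ G.dist u w := fun h => by
  have hle := hgirth.trans (egirth_le_of_adj_of_dist_eq hr hvw h)
  rw [Nat.cast_le] at hle
  omega

theorem dist_eq_add_one_or_of_adj_of_lt (hgirth : ((2 * d : ℕ) : ℕ∞) ≤ G.egirth)
    (hr : G.Reachable u v) (hvw : G.Adj v w) (hd : G.dist u v < d) :
    G.dist u w = G.dist u v + 1 ∨ G.dist u w + 1 = G.dist u v := by
  have hne := dist_ne_dist_of_adj_of_lt hgirth hr hvw hd
  have hv := dist_le_dist_add_one (u := u) hvw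
  have hw := dist_le_dist_add_one (u := u) hvw.symm
  omega

variable [Fintype V]

/-- The vertices at distance less than `d` from `v` whose distance from `u` is one larger. For
adjacent `u` and `v` in a graph of girth at least `2 * d`, this is the half rooted at `v` of the
Moore tree that grows from the edge `uv`. -/
noncomputable def halfTree (G : SimpleGraph V) (d : ℕ) (u v : V) : Finset V :=
  {s | G.dist v s < d ∧ G.dist u s = G.dist v s + 1}

@[simp]
theorem mem_halfTree : w ∈ halfTree G d u v ↔ G.dist v w < d ∧ G.dist u w = G.dist v w + 1 := by
  simp [halfTree]

variable [DecidableRel G.Adj]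

/-- The neighbours of `v` that precede `v` on a geodesic from `u`: the parents of `v` in the
breadth-first layering of `G` rooted at `u`. -/
noncomputable def parents (G : SimpleGraph V) [DecidableRel G.Adj] (u v : V) : Finset V :=
  {w ∈ G.neighborFinset v | G.dist u w + 1 = G.dist u v}

@[simp]
theorem mem_parents : w ∈ parents G u v ↔ G.Adj v w ∧ G.dist u w + 1 = G.dist u v := by
  simp [parents]

theorem card_parents (hgirth : ((2 * d : ℕ) : ℕ∞) ≤ G.egirth) (h0 : G.dist u v ≠ 0)
    (hd : G.dist u v < d) : #(parents G u v) = 1 := by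
  obtain ⟨w, hvw, hw⟩ := exists_adj_dist_add_one_eq h0
  refine card_eq_one.mpr ⟨w, eq_singleton_iff_unique_mem.mpr ⟨mem_parents.mpr ⟨hvw, hw⟩, ?_⟩⟩
  intro w' hw'
  rw [mem_parents] at hw'
  by_contra hne
  have hle := hgirth.trans (egirth_le_of_two_closer_neighbors hw'.1 hvw hne hw'.2 hw)
  rw [Nat.cast_le] at hle
  omega

theorem card_children (hgirth : ((2 * d : ℕ) : ℕ∞) ≤ G.egirth) (hk : G.IsRegularOfDegree k)
    (h0 : G.dist u v ≠ 0) (hd : G.dist u v < d) :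
    #{w ∈ G.neighborFinset v | G.dist u w = G.dist u v + 1} = k - 1 := by
  have hsplit := card_filter_add_card_filter_not (s := G.neighborFinset v)
    (fun w => G.dist u w + 1 = G.dist u v)
  rw [← parents, card_parents hgirth h0 hd, card_neighborFinset_eq_degree, hk.degree_eq] at hsplit
  rw [← hsplit, Nat.add_sub_cancel_left]
  refine congrArg card (filter_congr fun w hw => ?_)
  have := dist_eq_add_one_or_of_adj_of_lt hgirth (.of_dist_ne_zero h0)
    ((mem_neighborFinset _ _ _).mp hw) hd
  omega

theorem card_halfTree_layer (hgirth : ((2 * d : ℕ) : ℕ∞) ≤ G.egirth) (hk : G.IsRegularOfDegree k)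
    (huv : G.Adj u v) {j : ℕ} (hj : j < d) :
    #{s | G.dist v s = j ∧ G.dist u s = j + 1} = (k - 1) ^ j := by
  induction j with
  | zero =>
    rw [pow_zero, card_eq_one]
    refine ⟨v, eq_singleton_iff_unique_mem.mpr ⟨by simpa using dist_eq_one_iff_adj.mpr huv, ?_⟩⟩
    simp only [mem_filter_univ, zero_add, dist_eq_one_iff_adj]
    rintro s ⟨hvs, hus⟩
    exact ((huv.reachable.symm.trans hus.reachable).dist_eq_zero_iff.mp hvs).symm
  | succ j ih =>
    have hcount := card_mul_eq_card_mul G.Adj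
      (s := {s | G.dist v s = j ∧ G.dist u s = j + 1})
      (t := {s | G.dist v s = j + 1 ∧ G.dist u s = j + 1 + 1})
      (m := k - 1) (n := 1) ?_ ?_
    · rw [← mul_one #_, ← hcount, ih (by omega), pow_succ]
    · intro s hs
      rw [mem_filter_univ] at hs
      rw [← card_children hgirth hk (u := u) (v := s) (by omega) (by omega)]
      congr 1
      ext w
      simp only [mem_bipartiteAbove, mem_filter, mem_univ, true_and, mem_neighborFinset]
      have huw := dist_le_dist_add_one_left huv w
      refine ⟨fun ⟨_, hsw⟩ => ⟨hsw, by omega⟩, fun ⟨hsw, _⟩ => ?_⟩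
      have hvw := dist_le_dist_add_one (u := v) hsw.symm
      exact ⟨by omega, hsw⟩
    · intro s hs
      rw [mem_filter_univ] at hs
      refine Eq.trans (congrArg card ?_)
        (card_parents hgirth (u := v) (v := s) (by omega) (by omega))
      ext w
      simp only [mem_bipartiteBelow, mem_filter, mem_univ, true_and, mem_parents]
      have huw := dist_le_dist_add_one_left huv w
      refine ⟨fun ⟨_, hws⟩ => ⟨hws.symm, by omega⟩, fun ⟨hsw, _⟩ => ?_⟩
      have hus := dist_le_dist_add_one (u := u) hsw
      exact ⟨by omega, hsw.symm⟩

theorem card_halfTree (hgirth : ((2 * d : ℕ) : ℕ∞) ≤ G.egirth) (hk : G.IsRegularOfDegree k)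
    (huv : G.Adj u v) : #(halfTree G d u v) = ∑ j ∈ range d, (k - 1) ^ j := by
  rw [card_eq_sum_card_fiberwise (f := G.dist v) (t := range d)
    fun s hs => by simpa using (mem_halfTree.mp hs).1]
  refine sum_congr rfl fun j hj => ?_
  rw [mem_range] at hj
  rw [← card_halfTree_layer hgirth hk huv hj]
  congr 1
  ext s
  simp only [mem_filter, mem_halfTree, mem_univ, true_and]
  omega

theorem card_compl_halfTree_union [DecidableEq V] (hgirth : ((2 * d : ℕ) : ℕ∞) ≤ G.egirth)
    (hk : G.IsRegularOfDegree k) (hcard : Fintype.card V = 2 * ∑ j ∈ range d, (k - 1) ^ j + e)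
    (huv : G.Adj u v) : #(halfTree G d u v ∪ halfTree G d v u)ᶜ = e := by
  have hdisj : Disjoint (halfTree G d u v) (halfTree G d v u) :=
    disjoint_left.mpr fun s hv hu => by
      rw [mem_halfTree] at hv hu
      omega
  rw [card_compl, card_union_of_disjoint hdisj, card_halfTree hgirth hk huv,
    card_halfTree hgirth hk huv.symm, hcard]
  omega

theorem connected_of_excess_lt_degree (hd : 0 < d) (hgirth : ((2 * d : ℕ) : ℕ∞) ≤ G.egirth)
    (hk : G.IsRegularOfDegree k) (hcard : Fintype.card V = 2 * ∑ j ∈ range d, (k - 1) ^ j + e)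
    (he : e < k) : G.Connected := by
  classical
  have hne : Nonempty V := by
    rw [← Fintype.card_pos_iff, hcard]
    have : 0 < ∑ j ∈ range d, (k - 1) ^ j :=
      sum_pos' (fun _ _ => zero_le) ⟨0, mem_range.mpr hd, by simp⟩
    omega
  refine connected_iff _ |>.mpr ⟨fun u x => ?_, hne⟩
  by_contra hux
  obtain ⟨v, huv⟩ : ∃ v, G.Adj u v := (G.degree_pos_iff_exists_adj u).mp (by
    rw [hk.degree_eq]
    omega)
  have hsub : G.neighborFinset x ⊆ (halfTree G d u v ∪ halfTree G d v u)ᶜ := by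
    intro y hxy
    rw [mem_neighborFinset] at hxy
    have hu : G.dist u y = 0 :=
      dist_eq_zero_of_not_reachable fun h => hux (h.trans hxy.symm.reachable)
    have hv : G.dist v y = 0 := dist_eq_zero_of_not_reachable fun h =>
      hux (huv.reachable.trans (h.trans hxy.symm.reachable))
    simp [hu, hv]
  have hle := card_le_card hsub
  rw [card_neighborFinset_eq_degree, hk.degree_eq, card_compl_halfTree_union hgirth hk hcard huv]
    at hle
  omega

end MooreTree

section OuterGraph

variable {V : Type*} {G : SimpleGraph V} {d k e : ℕ} {u v p q s : V}

/-- The spanning subgraph of `G` whose edges are those joining two vertices at distance at least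
`d` from `u`. -/
def outerGraph (G : SimpleGraph V) (d : ℕ) (u : V) : SimpleGraph V where
  Adj s t := G.Adj s t ∧ d ≤ G.dist u s ∧ d ≤ G.dist u t
  symm := ⟨fun _ _ h => ⟨h.1.symm, h.2.2, h.2.1⟩⟩
  loopless := ⟨fun _ h => h.1.ne rfl⟩

theorem outerGraph_adj {t : V} :
    (outerGraph G d u).Adj s t ↔ G.Adj s t ∧ d ≤ G.dist u s ∧ d ≤ G.dist u t := Iff.rfl

theorem outerGraph_le : outerGraph G d u ≤ G := fun _ _ h => h.1

noncomputable instance [DecidableRel G.Adj] : DecidableRel (outerGraph G d u).Adj := fun s t =>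
  inferInstanceAs (Decidable (G.Adj s t ∧ d ≤ G.dist u s ∧ d ≤ G.dist u t))

variable [Fintype V]

/-- The vertices at distance at least `d` from both `u` and `v`; for an edge `uv`, these are the
excess vertices outside the Moore tree that grows from `uv`. -/
noncomputable def farSet (G : SimpleGraph V) (d : ℕ) (u v : V) : Finset V :=
  {s | d ≤ G.dist u s ∧ d ≤ G.dist v s}

@[simp]
theorem mem_farSet : s ∈ farSet G d u v ↔ d ≤ G.dist u s ∧ d ≤ G.dist v s := by
  simp [farSet]

theorem isVertexCover_farSet (hgirth : ((2 * d : ℕ) : ℕ∞) ≤ G.egirth) (hconn : G.Connected)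
    (huv : G.Adj u v) : (outerGraph G d u).IsVertexCover (farSet G d u v) := by
  rintro p q ⟨hpq, hp, hq⟩
  rw [mem_coe, mem_coe, mem_farSet, mem_farSet]
  have hup := dist_le_dist_add_one_left huv p
  have huq := dist_le_dist_add_one_left huv q
  have hvp := dist_ne_dist_of_adj_of_lt hgirth (hconn v p) hpq
  omega

theorem exists_adj_notMem_farSet (hd : 0 < d) (hp : G.dist u p = d) :
    ∃ v, G.Adj u v ∧ p ∉ farSet G d u v := by
  rw [dist_comm] at hp
  obtain ⟨v, huv, hv⟩ := exists_adj_dist_add_one_eq (by omega : G.dist p u ≠ 0)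
  refine ⟨v, huv, fun hmem => ?_⟩
  rw [mem_farSet, dist_comm (u := v)] at hmem
  omega

variable [DecidableRel G.Adj]

theorem card_farSet (hgirth : ((2 * d : ℕ) : ℕ∞) ≤ G.egirth) (hconn : G.Connected)
    (hk : G.IsRegularOfDegree k) (hcard : Fintype.card V = 2 * ∑ j ∈ range d, (k - 1) ^ j + e)
    (huv : G.Adj u v) : #(farSet G d u v) = e := by
  classical
  rw [← card_compl_halfTree_union hgirth hk hcard huv]
  congr 1
  ext s
  rw [mem_compl, mem_union, mem_halfTree, mem_halfTree, mem_farSet]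
  have hus := dist_ne_dist_of_adj_of_lt hgirth (hconn s u) huv
  have huv' := dist_le_dist_add_one_left huv s
  have hvu' := dist_le_dist_add_one_left huv.symm s
  rw [dist_comm, dist_comm (v := v)] at hus
  omega

theorem card_inner_neighbors_comm (hd : 2 ≤ d) (hgirth : ((2 * d : ℕ) : ℕ∞) ≤ G.egirth)
    (hs : d ≤ G.dist u s) :
    #{w ∈ G.neighborFinset s | G.dist u w < d} = #{v ∈ G.neighborFinset u | G.dist v s < d} := by
  -- The geodesics of length `d` between `u` and `s` match their first steps with their last ones.
  suffices h : #{w ∈ G.neighborFinset s | G.dist u w < d} * 1 =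
      #{v ∈ G.neighborFinset u | G.dist v s < d} * 1 by simpa using h
  refine card_mul_eq_card_mul (fun w v => G.dist v w + 2 = d) ?_ ?_
  · intro w hw
    rw [mem_filter, mem_neighborFinset] at hw
    have hsw := dist_le_dist_add_one (u := u) hw.1
    have hwu := G.dist_comm (u := w) (v := u)
    refine Eq.trans (congrArg card ?_) (card_parents hgirth (u := w) (v := u) (by omega) (by omega))
    ext v
    simp only [mem_bipartiteAbove, mem_filter, mem_neighborFinset, mem_parents]
    have hvw := G.dist_comm (u := v) (v := w)
    have hvs := dist_le_dist_add_one (u := v) hw.1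
    refine ⟨fun ⟨⟨huv, _⟩, _⟩ => ⟨huv, by omega⟩, fun ⟨huv, _⟩ => ⟨⟨huv, by omega⟩, by omega⟩⟩
  · intro v hv
    rw [mem_filter, mem_neighborFinset] at hv
    have hus := dist_le_dist_add_one_left hv.1 s
    refine Eq.trans (congrArg card ?_) (card_parents hgirth (u := v) (v := s) (by omega) (by omega))
    ext w
    simp only [mem_bipartiteBelow, mem_filter, mem_neighborFinset, mem_parents]
    have huw := dist_le_dist_add_one_left hv.1 w
    refine ⟨fun ⟨⟨hsw, _⟩, _⟩ => ⟨hsw, by omega⟩, fun ⟨hsw, _⟩ => ⟨⟨hsw, by omega⟩, by omega⟩⟩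

theorem degree_outerGraph (hd : 2 ≤ d) (hgirth : ((2 * d : ℕ) : ℕ∞) ≤ G.egirth)
    (hk : G.IsRegularOfDegree k) (hs : d ≤ G.dist u s) :
    (outerGraph G d u).degree s = #{v ∈ G.neighborFinset u | d ≤ G.dist v s} := by
  have hdeg : (outerGraph G d u).degree s = #{w ∈ G.neighborFinset s | d ≤ G.dist u w} := by
    rw [← card_neighborFinset_eq_degree]
    congr 1
    ext w
    simp [outerGraph_adj, hs]
  have hsplit (x y : V) : #{w ∈ G.neighborFinset x | d ≤ G.dist w y} +
      #{w ∈ G.neighborFinset x | G.dist w y < d} = k := by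
    simp only [← not_le]
    rw [card_filter_add_card_filter_not, card_neighborFinset_eq_degree, hk.degree_eq]
  have hs' := hsplit s u
  have hu := hsplit u s
  simp only [dist_comm (v := u)] at hs'
  rw [card_inner_neighbors_comm hd hgirth hs] at hs'
  omega

theorem le_degree_add_degree_outerGraph (hd : 2 ≤ d) (hgirth : ((2 * d : ℕ) : ℕ∞) ≤ G.egirth)
    (hconn : G.Connected) (hk : G.IsRegularOfDegree k) (hpq : (outerGraph G d u).Adj p q) :
    k ≤ (outerGraph G d u).degree p + (outerGraph G d u).degree q := by
  classical
  rw [degree_outerGraph hd hgirth hk hpq.2.1, degree_outerGraph hd hgirth hk hpq.2.2,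
    ← hk.degree_eq u, ← card_neighborFinset_eq_degree]
  refine le_trans (card_le_card fun v hv => ?_) (card_union_le _ _)
  have hcover := isVertexCover_farSet hgirth hconn ((mem_neighborFinset _ _ _).mp hv) hpq
  rw [mem_coe, mem_coe, mem_farSet, mem_farSet] at hcover
  rw [← filter_or, mem_filter]
  exact ⟨hv, hcover.imp And.right And.right⟩

end OuterGraph

section SmallExcess

variable {V : Type*} [Fintype V] {G : SimpleGraph V} [DecidableRel G.Adj] {d k e : ℕ}
  {u v w p q : V}

theorem dist_ne_of_adj_of_excess_add_two_le (hd : 3 ≤ d) (hgirth : ((2 * d : ℕ) : ℕ∞) ≤ G.egirth)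
    (hk : G.IsRegularOfDegree k) (hcard : Fintype.card V = 2 * ∑ j ∈ range d, (k - 1) ^ j + e)
    (he : e + 2 ≤ k) (hpq : G.Adj p q) (hp : G.dist u p = d) : G.dist u q ≠ d := by
  intro hq
  have hconn := connected_of_excess_lt_degree (by omega) hgirth hk hcard (by omega)
  have houter : 5 ≤ (outerGraph G d u).egirth :=
    le_trans (by exact_mod_cast (by omega : 5 ≤ 2 * d)) (hgirth.trans (egirth_anti outerGraph_le))
  have hedge : (outerGraph G d u).Adj p q := ⟨hpq, hp.ge, hq.ge⟩
  have hsum {r s : V} := le_degree_add_degree_outerGraph (p := r) (q := s) (u := u)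
    (by omega) hgirth hconn hk
  obtain ⟨v, huv, hpv⟩ := exists_adj_notMem_farSet (by omega) hp
  obtain ⟨w, huw, hqw⟩ := exists_adj_notMem_farSet (by omega) hq
  have hdegp : (outerGraph G d u).degree p ≤ e := by
    rw [← card_farSet hgirth hconn hk hcard huv, ← card_neighborFinset_eq_degree]
    exact card_le_card
      (neighborFinset_subset_of_isVertexCover (isVertexCover_farSet hgirth hconn huv) hpv)
  have hle := degree_add_degree_le_card_add_one_of_isVertexCover houter
    (isVertexCover_farSet hgirth hconn huw) hedge hqw fun r hpr => by
      have := hsum hpr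
      omega
  rw [card_farSet hgirth hconn hk hcard huw] at hle
  have := hsum hedge
  omega

theorem dist_le_or_dist_le_of_excess_lt_degree (hd : 0 < d) (hgirth : ((2 * d : ℕ) : ℕ∞) ≤ G.egirth)
    (hk : G.IsRegularOfDegree k) (hcard : Fintype.card V = 2 * ∑ j ∈ range d, (k - 1) ^ j + e)
    (he : e < k) (huv : G.Adj u v) (w : V) : G.dist u w ≤ d ∨ G.dist v w ≤ d := by
  by_contra! hfar
  have hconn := connected_of_excess_lt_degree hd hgirth hk hcard he
  have hsub : G.neighborFinset w ⊆ farSet G d u v := fun x hwx => by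
    rw [mem_neighborFinset] at hwx
    have hu := dist_le_dist_add_one (u := u) hwx
    have hv := dist_le_dist_add_one (u := v) hwx
    exact mem_farSet.mpr (by omega)
  have hle := card_le_card hsub
  rw [card_neighborFinset_eq_degree, hk.degree_eq, card_farSet hgirth hconn hk hcard huv] at hle
  omega

theorem dist_le_add_one_of_excess_lt_degree (hd : 0 < d) (hgirth : ((2 * d : ℕ) : ℕ∞) ≤ G.egirth)
    (hk : G.IsRegularOfDegree k) (hcard : Fintype.card V = 2 * ∑ j ∈ range d, (k - 1) ^ j + e)
    (he : e < k) (u v : V) : G.dist u v ≤ d + 1 := by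
  obtain ⟨w, huw⟩ := (G.degree_pos_iff_exists_adj u).mp (by rw [hk.degree_eq]; omega)
  have := dist_le_or_dist_le_of_excess_lt_degree hd hgirth hk hcard he huw v
  have := dist_le_dist_add_one_left huw v
  omega

theorem odd_dist_add_dist_of_excess_add_two_le (hd : 3 ≤ d) (hgirth : ((2 * d : ℕ) : ℕ∞) ≤ G.egirth)
    (hk : G.IsRegularOfDegree k) (hcard : Fintype.card V = 2 * ∑ j ∈ range d, (k - 1) ^ j + e)
    (he : e + 2 ≤ k) (u : V) (hvw : G.Adj v w) : Odd (G.dist u v + G.dist u w) := by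
  have hconn := connected_of_excess_lt_degree (by omega) hgirth hk hcard (by omega)
  have hne : G.dist u v ≠ G.dist u w := fun heq => by
    rcases lt_trichotomy (G.dist u v) d with hlt | hd' | hgt
    · exact dist_ne_dist_of_adj_of_lt hgirth (hconn u v) hvw hlt heq
    · exact dist_ne_of_adj_of_excess_add_two_le hd hgirth hk hcard he hvw hd' (heq ▸ hd')
    · have := dist_le_or_dist_le_of_excess_lt_degree (by omega) hgirth hk hcard (by omega) hvw u
      rw [dist_comm, dist_comm (v := u)] at this
      omega
  have hv := dist_le_dist_add_one (u := u) hvw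
  have hw := dist_le_dist_add_one (u := u) hvw.symm
  rw [Nat.odd_iff]
  omega

end SmallExcess

section DistanceMatrices

variable {V : Type*} {G : SimpleGraph V} {d k m j : ℕ}

/-- The sum `A_j + A_{j-2} + A_{j-4} + ⋯` of the distance matrices `A_i` of `G` with `i ≤ j` and
`i ≡ j (mod 2)`, for `G` connected. -/
noncomputable def parityBallMatrix (G : SimpleGraph V) (j : ℕ) : Matrix V V ℝ :=
  Matrix.of fun u v => if G.dist u v ≤ j ∧ Even (G.dist u v + j) then 1 else 0

theorem parityBallMatrix_apply (u v : V) : parityBallMatrix G j u v =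
    if G.dist u v ≤ j ∧ Even (G.dist u v + j) then 1 else 0 := rfl

theorem parityBallMatrix_zero [DecidableEq V] (hconn : G.Connected) :
    parityBallMatrix G 0 = 1 := by
  ext u v
  rw [parityBallMatrix_apply, Matrix.one_apply]
  refine if_congr ?_ rfl rfl
  rw [← hconn.dist_eq_zero_iff, Nat.even_iff]
  omega

theorem parityBallMatrix_one [DecidableRel G.Adj] :
    parityBallMatrix G 1 = G.adjMatrix ℝ := by
  ext u v
  rw [parityBallMatrix_apply, adjMatrix_apply]
  refine if_congr ?_ rfl rfl
  rw [← dist_eq_one_iff_adj, Nat.even_iff]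
  omega

theorem parityBallMatrix_add_distanceMatrix (hconn : G.Connected) :
    parityBallMatrix G j + G.distanceMatrix (j + 2) = parityBallMatrix G (j + 2) := by
  ext u v
  rw [Matrix.add_apply, SimpleGraph.distanceMatrix, Matrix.of_apply, parityBallMatrix_apply,
    parityBallMatrix_apply, ← (hconn u v).coe_dist_eq_edist]
  simp only [Nat.cast_inj, Nat.even_iff]
  split_ifs <;> first | omega | norm_num

variable [Fintype V] [DecidableRel G.Adj]

theorem adjMatrix_mul_parityBallMatrix_apply (u v : V) :
    (G.adjMatrix ℝ * parityBallMatrix G j) v u =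
      #{w ∈ G.neighborFinset v | G.dist u w ≤ j ∧ Even (G.dist u w + j)} := by
  simp only [adjMatrix_mul_apply, parityBallMatrix_apply, dist_comm (v := u), sum_boole]

theorem adjMatrix_mul_parityBallMatrix (hgirth : ((2 * d : ℕ) : ℕ∞) ≤ G.egirth)
    (hconn : G.Connected) (hk : G.IsRegularOfDegree k) (hj : j + 2 < d) :
    G.adjMatrix ℝ * parityBallMatrix G (j + 1) =
      parityBallMatrix G (j + 2) + ((k : ℝ) - 1) • parityBallMatrix G j := by
  ext v u
  rw [adjMatrix_mul_parityBallMatrix_apply, Matrix.add_apply, Matrix.smul_apply,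
    parityBallMatrix_apply, parityBallMatrix_apply, dist_comm (u := v), smul_eq_mul]
  have hstep {w : V} (hw : w ∈ G.neighborFinset v) :=
    dist_eq_add_one_or_of_adj_of_lt hgirth (hconn u v) ((mem_neighborFinset _ _ _).mp hw)
  have hlip {w : V} (hw : w ∈ G.neighborFinset v) :=
    dist_le_dist_add_one (u := u) ((mem_neighborFinset _ _ _).mp hw)
  simp only [Nat.even_iff]
  rcases lt_trichotomy (G.dist u v) (j + 2) with hlt | heq | hgt
  · rcases Nat.mod_two_eq_zero_or_one (G.dist u v + j) with heven | hodd
    · rw [filter_true_of_mem fun w hw => by have := hstep hw; omega,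
        card_neighborFinset_eq_degree, hk.degree_eq, if_pos (by omega), if_pos (by omega)]
      ring
    · rw [filter_false_of_mem fun w hw => by have := hstep hw; omega,
        if_neg (by omega), if_neg (by omega)]
      simp
  · have hparents : #{w ∈ G.neighborFinset v |
        G.dist u w ≤ j + 1 ∧ (G.dist u w + (j + 1)) % 2 = 0} = 1 := by
      refine Eq.trans (congrArg card (filter_congr fun w hw => ?_))
        (card_parents hgirth (u := u) (v := v) (by omega) (by omega))
      have := hstep hw
      omega
    rw [hparents, if_pos (by omega), if_neg (by omega)]
    simp
  · rw [filter_false_of_mem fun w hw => by have := hlip hw; omega,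
      if_neg (by omega), if_neg (by omega)]
    simp

theorem aeval_dickson_eq_parityBallMatrix [DecidableEq V] (hgirth : ((2 * d : ℕ) : ℕ∞) ≤ G.egirth)
    (hconn : G.Connected) (hk : G.IsRegularOfDegree k) (hj : j < d) :
    Polynomial.aeval (G.adjMatrix ℝ) (Polynomial.dickson 2 ((k : ℝ) - 1) j) =
      parityBallMatrix G j := by
  induction j using Nat.twoStepInduction with
  | zero =>
    rw [parityBallMatrix_zero hconn, Polynomial.dickson_zero, map_sub, map_ofNat, map_natCast]
    norm_num
  | one => rw [Polynomial.dickson_one, Polynomial.aeval_X, parityBallMatrix_one]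
  | more j ih ih' =>
    rw [Polynomial.dickson_add_two, map_sub, map_mul, map_mul, Polynomial.aeval_X,
      Polynomial.aeval_C, ← Algebra.smul_def, ih (by omega), ih' (by omega),
      adjMatrix_mul_parityBallMatrix hgirth hconn hk hj, add_sub_cancel_right]

theorem adjMatrix_add_smul_one_mul_parityBallMatrix [DecidableEq V] (hk : G.IsRegularOfDegree k)
    (hodd : ∀ u v w, G.Adj v w → Odd (G.dist u v + G.dist u w)) (hdist : ∀ u v, G.dist u v ≤ m) :
    (G.adjMatrix ℝ + (k : ℝ) • (1 : Matrix V V ℝ)) * parityBallMatrix G m =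
      (k : ℝ) • allOnesMatrix V := by
  ext v u
  rw [add_mul, smul_mul_assoc, one_mul, Matrix.add_apply, adjMatrix_mul_parityBallMatrix_apply,
    Matrix.smul_apply, Matrix.smul_apply, parityBallMatrix_apply, allOnesMatrix, Matrix.of_apply,
    dist_comm (u := v)]
  have hflip {w : V} (hw : w ∈ G.neighborFinset v) :=
    Nat.odd_iff.mp (hodd u v w ((mem_neighborFinset _ _ _).mp hw))
  simp only [hdist, true_and, Nat.even_iff]
  split_ifs with heven
  · rw [filter_false_of_mem fun w hw => by have := hflip hw; omega]
    simp
  · rw [filter_true_of_mem fun w hw => by have := hflip hw; omega,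
      card_neighborFinset_eq_degree, hk.degree_eq]
    simp

end DistanceMatrices

theorem card_eq_of_isKGGraphOfExcess {V : Type*} [Fintype V] {G : SimpleGraph V}
    [DecidableRel G.Adj] {k d e : ℕ} (hk : 0 < k) (hG : G.IsKGGraphOfExcess k (2 * d) e) :
    Fintype.card V = 2 * ∑ j ∈ range d, (k - 1) ^ j + e := by
  have hcard := hG.2
  rw [mooreBound, if_neg (by simp), Nat.mul_div_cancel_left _ two_pos, sub_eq_iff_eq_add'] at hcard
  zify [Nat.one_le_iff_ne_zero.mpr hk.ne']
  exact hcard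

theorem mainTheorem1_general {V : Type*} [Fintype V] [DecidableEq V] (G : SimpleGraph V)
    [DecidableRel G.Adj] (k g d e : ℕ) (he : e + 2 ≤ k) (hg : 6 ≤ g) (hgd : g = 2 * d)
    (hG : G.IsKGGraphOfExcess k g e) :
    (k : ℝ) • allOnesMatrix V =
      (G.adjMatrix ℝ + (k : ℝ) • (1 : Matrix V V ℝ)) *
        (Polynomial.aeval (G.adjMatrix ℝ) (Polynomial.dickson 2 ((k : ℝ) - 1) (d - 1)) +
          G.distanceMatrix (d + 1)) := by
  subst hgd
  have hcard := card_eq_of_isKGGraphOfExcess (by omega) hG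
  obtain ⟨⟨hk, hgirth⟩, -⟩ := hG
  have hconn := connected_of_excess_lt_degree (by omega) hgirth.ge hk hcard (by omega)
  have hodd (u v w : V) (hvw : G.Adj v w) : Odd (G.dist u v + G.dist u w) :=
    odd_dist_add_dist_of_excess_add_two_le (by omega) hgirth.ge hk hcard he u hvw
  have hdist := dist_le_add_one_of_excess_lt_degree (by omega) hgirth.ge hk hcard (by omega)
  obtain ⟨d, rfl⟩ := Nat.exists_eq_add_of_le' (by omega : 1 ≤ d)
  rw [Nat.add_sub_cancel, aeval_dickson_eq_parityBallMatrix hgirth.ge hconn hk d.lt_succ_self,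
    parityBallMatrix_add_distanceMatrix hconn,
    adjMatrix_add_smul_one_mul_parityBallMatrix hk hodd hdist]

theorem mainTheorem1 {V : Type*} [Fintype V] [DecidableEq V] (G : SimpleGraph V)
    [DecidableRel G.Adj] (k g d : ℕ) (hk : 6 ≤ k) (hg : 6 ≤ g) (hgd : g = 2 * d)
    (hG : G.IsKGGraphOfExcess k g 4) :
    (k : ℝ) • allOnesMatrix V =
      (G.adjMatrix ℝ + (k : ℝ) • (1 : Matrix V V ℝ)) *
        (Polynomial.aeval (G.adjMatrix ℝ) (Polynomial.dickson 2 ((k : ℝ) - 1) (d - 1)) +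
          G.distanceMatrix (d + 1)) :=
  mainTheorem1_general G k g d 4 hk hg hgd (by exact_mod_cast hG)
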